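/- Let the scalar field be $\mathbb{R}$ or $\mathbb{C}$. For $\alpha>0$ let $$Y_\alpha=(\ell_1,\alpha\|\cdot\|_1)\oplus_1 (C[1,\omega],\|\cdot\|_\infty),$$ where $\omega$ is the first infinite ordinal and $C[1,\omega]$ is the space of continuous scalar functions on the ordinal interval $[1,\omega]$; let $X_\alpha$ be the closed linear span in $Y_\alpha$ of the vectors $x_k=(e_k,\chi_{[k,\omega]})$, $k\in\mathbb{N}=\{1,2,\dots\}$, where $e_k$ is the $k$-th canonical basis vector of $\ell_1$ and $\chi_{[k,\omega]}$ is the characteristic function of $[k,\omega]$. Let $$X=\Big(\sum_{n=1}^\infty X_{1/n}\Big)_{\ell_1}$$ be the $\ell_1$-sum of the spaces $X_{1/n}$. For a bounded sequence $(x_k)$ in $X$ let $\operatorname{clust}_X(x_k)\subset X^{**}$ be the set of its weak* cluster points in $X^{**}$, let $\delta_X(x_k)$ be the norm diameter of $\operatorname{clust}_X(x_k)$, and let $\operatorname{d}(\operatorname{clust}_X(x_k),X)=\inf\{\|a-y\|: a\in\operatorname{clust}_X(x_k),\ y\in X\}$, where $X$ is identified with its canonical image in $X^{**}$. Then $X$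 is a separable Banach space with the Schur property (every weakly convergent sequence is norm convergent); in particular, $X$ is weakly sequentially complete (every weakly Cauchy sequence is weakly convergent). Moreover, $X$ is $1$-complemented in its bidual, i.e. there is a linear projection of $X^{**}$ onto $X$ of norm at most $1$. Finally, there is no constant $C\ge 0$ such that $$\operatorname{d}(\operatorname{clust}_X(x_k),X)\le C\cdot\delta_X(x_k)$$ for every bounded sequence $(x_k)$ in $X$. -/

import Mathlib

open Filter Topology
open scoped NNReal ENNReal

noncomputable section

section Notions

variable (𝕜 : Type*) [RCLike 𝕜] (X : Type*) [NormedAddCommGroup X] [NormedSpace 𝕜 X]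

/-- The Schur property: every weakly convergent sequence converges in norm (to the same limit). -/
def SchurProperty : Prop :=
  ∀ (x : ℕ → X) (a : X),
    Tendsto (fun k => toWeakSpace 𝕜 X (x k)) atTop (𝓝 (toWeakSpace 𝕜 X a)) →
      Tendsto x atTop (𝓝 a)

/-- Weak sequential completeness: every weakly Cauchy sequence (a sequence `x` such that the
scalar sequence `f (x k)` is Cauchy for each continuous functional `f`) is weakly convergent. -/
def WeaklySequentiallyComplete : Prop :=
  ∀ x : ℕ → X, (∀ f : StrongDual 𝕜 X, CauchySeq fun k => f (x k)) →
    ∃ a : X, Tendsto (fun k => toWeakSpace 𝕜 X (x k)) atTop (𝓝 (toWeakSpace 𝕜 X a))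

/-- The canonical image of `X` in its bidual is the range of a linear projection of norm at
most `1` on the bidual, that is, of a linear projection `P` with `‖P φ‖ ≤ ‖φ‖` for all `φ`. (Such a projection has norm exactly `1` unless `X` is zero.) -/
def OneComplementedInBidual : Prop :=
  ∃ P : StrongDual 𝕜 (StrongDual 𝕜 X) →L[𝕜] StrongDual 𝕜 (StrongDual 𝕜 X),
    (∀ φ, ‖P φ‖ ≤ ‖φ‖) ∧ P.comp P = P ∧
      Set.range P = Set.range (NormedSpace.inclusionInDoubleDual 𝕜 X)

variable {X}

/-- The set of all weak* cluster points in the bidual `X**` of a sequence in `X`. -/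
def clust (x : ℕ → X) : Set (StrongDual 𝕜 (StrongDual 𝕜 X)) :=
  {φ | MapClusterPt (StrongDual.toWeakDual φ) atTop
    fun k => StrongDual.toWeakDual (NormedSpace.inclusionInDoubleDual 𝕜 X (x k))}

/-- `δ_X(x_k)`: the norm diameter of the set of weak* cluster points. -/
def deltaX (x : ℕ → X) : ℝ≥0∞ := Metric.ediam (clust 𝕜 x)

/-- `d(clust_X(x_k), X)`: the usual distance `inf {‖a - b‖ : a ∈ A, b ∈ B}` of the set `A` of
weak* cluster points from the canonical copy `B` of `X` in the bidual. -/
def distClust (x : ℕ → X) : ℝ≥0∞ :=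
  ⨅ φ ∈ clust 𝕜 x, ⨅ y : X, edist φ (NormedSpace.inclusionInDoubleDual 𝕜 X y)

end Notions

section Space

/-- The space `(ℓ₁, α ‖·‖₁)`: a copy of `ℓ₁`, normed below by `α` times the usual norm. -/
def ScaledL1 (𝕜 : Type*) [RCLike 𝕜] (_α : {r : ℝ // 0 < r}) : Type _ :=
  lp (fun _ : ℕ => 𝕜) 1

variable (𝕜 : Type*) [RCLike 𝕜] (α : {r : ℝ // 0 < r})

namespace ScaledL1

instance : AddCommGroup (ScaledL1 𝕜 α) :=
  inferInstanceAs (AddCommGroup (lp (fun _ : ℕ => 𝕜) 1))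

instance : Module 𝕜 (ScaledL1 𝕜 α) :=
  inferInstanceAs (Module 𝕜 (lp (fun _ : ℕ => 𝕜) 1))

/-- The identity map from `ℓ₁` to `(ℓ₁, α ‖·‖₁)`. -/
def ofL1 : lp (fun _ : ℕ => 𝕜) 1 ≃ₗ[𝕜] ScaledL1 𝕜 α := LinearEquiv.refl 𝕜 _

instance : Norm (ScaledL1 𝕜 α) := ⟨fun η => (α : ℝ) * ‖(ofL1 𝕜 α).symm η‖⟩

theorem norm_def (η : ScaledL1 𝕜 α) : ‖η‖ = (α : ℝ) * ‖(ofL1 𝕜 α).symm η‖ := rfl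

theorem core : NormedSpace.Core 𝕜 (ScaledL1 𝕜 α) where
  norm_nonneg η := mul_nonneg α.2.le (norm_nonneg _)
  norm_smul c η := by
    rw [norm_def, norm_def, map_smul, norm_smul]
    ring
  norm_triangle η ζ := by
    rw [norm_def, norm_def, norm_def, map_add, ← mul_add]
    exact mul_le_mul_of_nonneg_left (norm_add_le _ _) α.2.le
  norm_eq_zero_iff η := by
    rw [norm_def, mul_eq_zero, norm_eq_zero, LinearEquiv.map_eq_zero_iff]
    exact or_iff_right α.2.ne'

instance : NormedAddCommGroup (ScaledL1 𝕜 α) := NormedAddCommGroup.ofCore (core 𝕜 α)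

instance : NormedSpace 𝕜 (ScaledL1 𝕜 α) := NormedSpace.ofCore (core 𝕜 α)

end ScaledL1

/-- `Y_α = (ℓ₁, α ‖·‖₁) ⊕₁ C[1, ω]`. The ordinal interval `[1, ω]` is represented by the order
isomorphic `ℕ∞` with its order topology (which amounts to numbering from `0` instead of `1`). -/
abbrev YSpace : Type _ := WithLp 1 (ScaledL1 𝕜 α × C(ℕ∞, 𝕜))

theorem isClopen_Ici_natCast (k : ℕ) : IsClopen (Set.Ici (k : ℕ∞)) := by
  refine ⟨isClosed_Ici, ?_⟩
  cases k with
  | zero => simp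
  | succ m =>
    have h : Set.Ici ((m + 1 : ℕ) : ℕ∞) = Set.Ioi (m : ℕ∞) := by
      ext n
      simp [ENat.add_one_le_iff (ENat.natCast_ne_top m)]
    rw [h]
    exact isOpen_Ioi

/-- The characteristic function `χ_[k, ω]`, as a continuous function. -/
def chi (k : ℕ) : C(ℕ∞, 𝕜) where
  toFun := Set.indicator (Set.Ici (k : ℕ∞)) 1
  continuous_toFun := (continuous_const (y := (1 : 𝕜))).indicator fun a ha => by
    rw [(isClopen_Ici_natCast k).frontier_eq] at ha
    exact ha.elim

/-- The vector `x_k = (e_k, χ_[k, ω])` of `Y_α`. -/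
def xVec (k : ℕ) : YSpace 𝕜 α :=
  WithLp.toLp 1 (ScaledL1.ofL1 𝕜 α (lp.single 1 k 1), chi 𝕜 k)

/-- `X_α`, the closed linear span of the vectors `x_k` in `Y_α`. -/
def XAlpha : Submodule 𝕜 (YSpace 𝕜 α) :=
  (Submodule.span 𝕜 (Set.range (xVec 𝕜 α))).topologicalClosure

/-- The positive number `1 / n`, for `n = 1, 2, 3, …`. -/
def oneDiv (n : ℕ+) : {r : ℝ // 0 < r} :=
  ⟨1 / ((n : ℕ) : ℝ), one_div_pos.mpr (Nat.cast_pos.mpr n.pos)⟩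

/-- The `ℓ₁`-sum of the spaces `X_{1/n}`, `n = 1, 2, 3, …`. -/
abbrev XSpace : Type _ := lp (fun n : ℕ+ => XAlpha 𝕜 (oneDiv n)) 1

end Space

end

/-! An element of `X_α` is determined by its `ℓ₁` part `η`: its function part at `n` is the partial
sum of `η` up to `n`. Hence the norm is `α ‖η‖₁ + sup_n |∑_{k ≤ n} η k|`, an equivalent norm on
`ℓ₁`, and the Schur property is inherited from `ℓ₁`. A gliding hump (`schurProperty_lp_one`) carries
it to `ℓ₁`-sums.

For the projection, an element of the bidual is evaluated on the coordinate functionals. The norm is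
a supremum of finite expressions in the coordinates, so the resulting sequence defines a vector of
no larger norm (`BidualTraceSet.of_coord`, `BidualTraceSet.lp_one`).

The inequality fails along `(x_k)` in the summand `X_{1/n}`. The `χ_[k, ω]` are weakly Cauchy, so
only the `ℓ₁` part, of norm `1/n`, can separate cluster points: `δ ≤ 2/n`. Yet each cluster point
takes the value `1` on every functional "value at `ω` minus value at `m`", while on a fixed element
of `X` these tend to `0` by continuity; so the distance to `X` is at least `1/2`. -/

section Weak

/-! ### Weak convergence and the Schur property -/

variable {𝕜 : Type*} [RCLike 𝕜] {X : Type*} [NormedAddCommGroup X] [NormedSpace 𝕜 X]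

theorem tendsto_toWeakSpace_iff {ι : Type*} {l : Filter ι} {x : ι → X} {a : X} :
    Tendsto (fun k => toWeakSpace 𝕜 X (x k)) l (𝓝 (toWeakSpace 𝕜 X a)) ↔
      ∀ f : StrongDual 𝕜 X, Tendsto (fun k => f (x k)) l (𝓝 (f a)) := by
  refine WeakBilin.tendsto_iff_forall_eval_tendsto _ ?_
  intro u v huv
  refine (SeparatingDual.eq_iff_forall_dual_eq (R := 𝕜)).2 fun g => ?_
  exact LinearMap.congr_fun huv g

theorem schurProperty_iff_null :
    SchurProperty 𝕜 X ↔ ∀ x : ℕ → X,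
      (∀ f : StrongDual 𝕜 X, Tendsto (fun k => f (x k)) atTop (𝓝 0)) → Tendsto x atTop (𝓝 0) := by
  constructor
  · intro h x hx
    exact h x 0 (tendsto_toWeakSpace_iff.2 fun f => by simpa using hx f)
  · intro h x a hx
    refine tendsto_sub_nhds_zero_iff.1 (h (fun k => x k - a) fun f => ?_)
    simpa using tendsto_sub_nhds_zero_iff.2 (tendsto_toWeakSpace_iff.1 hx f)

/-- If a weakly Cauchy sequence were not norm Cauchy, differences along two index sequences would be
weakly null but bounded away from `0`. -/
theorem SchurProperty.weaklySequentiallyComplete [CompleteSpace X] (h : SchurProperty 𝕜 X) :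
    WeaklySequentiallyComplete 𝕜 X := by
  intro x hx
  have hc : CauchySeq x := by
    by_contra hcon
    rw [Metric.cauchySeq_iff] at hcon
    push Not at hcon
    obtain ⟨ε, hε, H⟩ := hcon
    choose m hm n hn hmn using H
    have hm' : Tendsto m atTop atTop := tendsto_atTop_mono hm tendsto_id
    have hn' : Tendsto n atTop atTop := tendsto_atTop_mono hn tendsto_id
    have h0 := schurProperty_iff_null.1 h (fun k => x (m k) - x (n k)) fun f => by
      obtain ⟨c, hc⟩ := cauchySeq_tendsto_of_complete (hx f)
      simpa using (hc.comp hm').sub (hc.comp hn')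
    obtain ⟨k, hk⟩ := ((tendsto_zero_iff_norm_tendsto_zero.1 h0).eventually_lt_const hε).exists
    exact (hmn k).not_gt (by simpa [dist_eq_norm] using hk)
  obtain ⟨a, ha⟩ := cauchySeq_tendsto_of_complete hc
  exact ⟨a, tendsto_toWeakSpace_iff.2 fun f => (f.continuous.tendsto a).comp ha⟩

theorem schurProperty_scalar : SchurProperty 𝕜 𝕜 :=
  schurProperty_iff_null.2 fun x hx => by
    simpa using hx (ContinuousLinearMap.id 𝕜 𝕜)

/-- A normed space that maps into a space with the Schur property by a continuous linear map bounded
below has the Schur property. -/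
theorem SchurProperty.of_antilipschitz {Z : Type*} [NormedAddCommGroup Z] [NormedSpace 𝕜 Z]
    (h : SchurProperty 𝕜 Z) (T : X →L[𝕜] Z) {C : ℝ} (hT : ∀ x, ‖x‖ ≤ C * ‖T x‖) :
    SchurProperty 𝕜 X := by
  refine schurProperty_iff_null.2 fun x hx => ?_
  have h1 := schurProperty_iff_null.1 h (fun k => T (x k)) fun f => hx (f.comp T)
  refine squeeze_zero_norm (fun k => hT (x k)) ?_
  simpa using h1.norm.const_mul C

end Weak

/-! ### `ℓ₁`-sums: functionals, gliding hump, separability -/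

section L1Sum

variable {𝕜 : Type*} [RCLike 𝕜] {ι : Type*} {E : ι → Type*} [∀ i, NormedAddCommGroup (E i)]
  [∀ i, NormedSpace 𝕜 (E i)]

namespace lp

theorem summable_norm_of_one (x : lp E 1) : Summable fun i => ‖x i‖ := by
  simpa using (lp.memℓp x).summable (by simp)

theorem norm_eq_tsum_of_one (x : lp E 1) : ‖x‖ = ∑' i, ‖x i‖ := by
  simpa using lp.norm_eq_tsum_rpow (p := 1) (by simp) x

theorem sum_norm_le_of_one (x : lp E 1) (F : Finset ι) : ∑ i ∈ F, ‖x i‖ ≤ ‖x‖ := by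
  rw [norm_eq_tsum_of_one]
  exact (summable_norm_of_one x).sum_le_tsum F fun _ _ => norm_nonneg _

theorem summable_apply_of_one {f : ∀ i, StrongDual 𝕜 (E i)} (hf : ∀ i, ‖f i‖ ≤ 1) (x : lp E 1) :
    Summable fun i => f i (x i) :=
  .of_norm_bounded (summable_norm_of_one x) fun i =>
    ((f i).le_of_opNorm_le (hf i) _).trans_eq (one_mul _)

/-- The functional on an `ℓ₁`-sum given by a family of functionals of norm at most `1`. -/
theorem exists_dual_of_one {f : ∀ i, StrongDual 𝕜 (E i)} (hf : ∀ i, ‖f i‖ ≤ 1) :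
    ∃ g : StrongDual 𝕜 (lp E 1), ‖g‖ ≤ 1 ∧ ∀ x, g x = ∑' i, f i (x i) := by
  let g : lp E 1 →ₗ[𝕜] 𝕜 :=
    { toFun := fun x => ∑' i, f i (x i)
      map_add' := fun x y => by
        rw [← (summable_apply_of_one hf x).tsum_add (summable_apply_of_one hf y)]
        simp
      map_smul' := fun c x => by
        simp [tsum_mul_left] }
  have hg : ∀ x, ‖g x‖ ≤ 1 * ‖x‖ := fun x => by
    rw [one_mul, norm_eq_tsum_of_one]
    exact tsum_of_norm_bounded (summable_norm_of_one x).hasSum fun i =>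
      ((f i).le_of_opNorm_le (hf i) _).trans_eq (one_mul _)
  exact ⟨g.mkContinuous 1 hg, g.mkContinuous_norm_le zero_le_one hg, fun x => rfl⟩

/-- A functional that norms the coordinates of `x` in `B` is almost norming for `x` if the
coordinates outside of `B` are small. -/
theorem two_mul_sum_sub_norm_le {f : ∀ i, StrongDual 𝕜 (E i)} (hf : ∀ i, ‖f i‖ ≤ 1) (x : lp E 1)
    (B : Finset ι) (hB : ∀ i ∈ B, f i (x i) = ‖x i‖) :
    2 * ∑ i ∈ B, ‖x i‖ - ‖x‖ ≤ ‖∑' i, f i (x i)‖ := by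
  have hs := summable_norm_of_one x
  have h1 := hs.sum_add_tsum_subtype_compl B
  have h2 := (summable_apply_of_one hf x).sum_add_tsum_subtype_compl B
  have h3 : ‖∑' i : {i // i ∉ B}, f i (x i)‖ ≤ ∑' i : {i // i ∉ B}, ‖x i‖ :=
    tsum_of_norm_bounded (hs.subtype _).hasSum fun i =>
      ((f i).le_of_opNorm_le (hf i) _).trans_eq (one_mul _)
  have h4 : ‖∑ i ∈ B, f i (x i)‖ = ∑ i ∈ B, ‖x i‖ := by
    rw [Finset.sum_congr rfl hB, ← RCLike.ofReal_sum, RCLike.norm_ofReal,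
      abs_of_nonneg (Finset.sum_nonneg fun _ _ => norm_nonneg _)]
  rw [norm_eq_tsum_of_one, ← h1, ← h2]
  have h5 := norm_sub_le (∑ i ∈ B, f i (x i) + ∑' i : {i // i ∉ B}, f i (x i))
    (∑' i : {i // i ∉ B}, f i (x i))
  rw [add_sub_cancel_right, h4] at h5
  linarith

end lp

/-- An `ℓ₁`-sum of spaces with the Schur property has the Schur property. -/
theorem schurProperty_lp_one (h : ∀ i, SchurProperty 𝕜 (E i)) : SchurProperty 𝕜 (lp E 1) := by
  classical
  refine schurProperty_iff_null.2 fun x hx => ?_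
  have hcoord : ∀ i, Tendsto (fun k => ‖x k i‖) atTop (𝓝 0) := fun i => by
    rw [← tendsto_zero_iff_norm_tendsto_zero]
    exact schurProperty_iff_null.1 (h i) _ fun f => hx (f.comp (lp.evalCLM 𝕜 E 1 i))
  by_contra hcon
  rw [tendsto_zero_iff_norm_tendsto_zero, Metric.tendsto_atTop] at hcon
  push Not at hcon
  obtain ⟨ε, hε, hlarge⟩ := hcon
  -- Gliding hump: some late `x k` of norm at least `ε` has mass at most `ε / 8` on `F` and at most
  -- `ε / 8` off `G`.
  have hstep : ∀ (F : Finset ι) (N : ℕ), ∃ k, N ≤ k ∧ ∃ G : Finset ι, F ⊆ G ∧ ε ≤ ‖x k‖ ∧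
      ∑ i ∈ F, ‖x k i‖ ≤ ε / 8 ∧ ‖x k‖ ≤ ∑ i ∈ G, ‖x k i‖ + ε / 8 := by
    intro F N
    have h0 : Tendsto (fun k => ∑ i ∈ F, ‖x k i‖) atTop (𝓝 0) := by
      simpa using tendsto_finsetSum F fun i _ => hcoord i
    obtain ⟨M, hM⟩ := eventually_atTop.1 (h0.eventually_le_const (show 0 < ε / 8 by positivity))
    obtain ⟨k, hk, hkε⟩ := hlarge (max M N)
    have hs : HasSum (fun i => ‖x k i‖) ‖x k‖ :=
      lp.norm_eq_tsum_of_one (x k) ▸ (lp.summable_norm_of_one (x k)).hasSum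
    obtain ⟨G, hFG, hG⟩ := (((eventually_ge_atTop F).and
      (hs.eventually_const_le (show ‖x k‖ - ε / 8 < ‖x k‖ by linarith)))).exists
    exact ⟨k, (le_max_right _ _).trans hk, G, hFG, by simpa using hkε,
      hM k ((le_max_left _ _).trans hk), by linarith⟩
  choose K hK G hFG hKε hhead htail using hstep
  -- The state is the set of coordinates used so far and the least index still allowed; the humps
  -- live on the disjoint blocks `(s (j + 1)).1 \ (s j).1`.
  let s : ℕ → Finset ι × ℕ :=
    fun j => Nat.rec (∅, 0) (fun _ p => (G p.1 p.2, K p.1 p.2 + 1)) j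
  have hs1 : ∀ j, s (j + 1) = (G (s j).1 (s j).2, K (s j).1 (s j).2 + 1) := fun _ => rfl
  let k : ℕ → ℕ := fun j => K (s j).1 (s j).2
  have hmono : Monotone fun j => (s j).1 := monotone_nat_of_le_succ fun j => by
    rw [hs1]
    exact hFG _ _
  have hk : Tendsto k atTop atTop := by
    refine tendsto_atTop_mono (f := id) (fun j => ?_) tendsto_id
    have : j ≤ (s j).2 := by
      induction j with
      | zero => simp
      | succ j ih =>
        rw [hs1]
        exact Nat.succ_le_succ (ih.trans (hK _ _))
    exact this.trans (hK _ _)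
  choose D hD1 hD2 using fun j i => exists_dual_vector'' 𝕜 (x (k j) i)
  -- `Nat.find` returns the number of the block containing `i`, so one family of functionals norms
  -- every hump on its own block.
  let f : ∀ i, StrongDual 𝕜 (E i) := fun i =>
    if hi : ∃ j, i ∈ (s (j + 1)).1 then D (Nat.find hi) i else 0
  have hf : ∀ i, ‖f i‖ ≤ 1 := fun i => by
    by_cases hi : ∃ j, i ∈ (s (j + 1)).1
    · simp only [f, dif_pos hi, hD1]
    · simp [f, dif_neg hi]
  have hfD : ∀ j, ∀ i ∈ (s (j + 1)).1 \ (s j).1, f i (x (k j) i) = ‖x (k j) i‖ := by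
    intro j i hij
    rw [Finset.mem_sdiff] at hij
    have hi : ∃ j, i ∈ (s (j + 1)).1 := ⟨j, hij.1⟩
    have hj : Nat.find hi = j := by
      refine (Nat.find_eq_iff hi).2 ⟨hij.1, fun m hm hmem => hij.2 (hmono hm hmem)⟩
    simp only [f, dif_pos hi, hj, hD2]
  obtain ⟨g, -, hg⟩ := lp.exists_dual_of_one hf
  -- The block carries at least `‖x‖ - ε / 4`, so the bound is `2 (‖x‖ - ε / 4) - ‖x‖ ≥ ε / 2`.
  have hlow : ∀ j, ε / 2 ≤ ‖g (x (k j))‖ := by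
    intro j
    have h1 := lp.two_mul_sum_sub_norm_le hf (x (k j)) _ (hfD j)
    have h2 := Finset.sum_sdiff (f := fun i => ‖x (k j) i‖) (hmono (Nat.le_succ j))
    have h3 : ∑ i ∈ (s j).1, ‖x (k j) i‖ ≤ ε / 8 := hhead _ _
    have h4 : ‖x (k j)‖ ≤ ∑ i ∈ (s (j + 1)).1, ‖x (k j) i‖ + ε / 8 := htail _ _
    have h5 : ε ≤ ‖x (k j)‖ := hKε _ _
    rw [hg]
    simp only [Nat.succ_eq_add_one] at h2
    linarith
  have h0 := ((hx g).comp hk).norm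
  rw [norm_zero] at h0
  have := ge_of_tendsto' h0 hlow
  linarith

theorem separableSpace_lp_one [Countable ι] [∀ i, TopologicalSpace.SeparableSpace (E i)] :
    TopologicalSpace.SeparableSpace (lp E 1) := by
  classical
  have h1 : TopologicalSpace.IsSeparable (⋃ i, Set.range (lp.single (E := E) 1 i)) :=
    .iUnion fun i => TopologicalSpace.isSeparable_range (lp.isometry_single i).continuous
  -- Integer coefficients suffice, since each range is already closed under scalars.
  have h2 := (h1.span (R := ℤ)).closure
  rw [← TopologicalSpace.isSeparable_univ_iff]
  refine h2.mono fun x _ => ?_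
  refine mem_closure_of_tendsto (lp.hasSum_single (by simp) x) (Eventually.of_forall fun F => ?_)
  exact Submodule.sum_mem _ fun i _ => Submodule.subset_span (Set.mem_iUnion.2 ⟨i, _, rfl⟩)

end L1Sum

/-! ### Projections from the bidual -/

section Bidual

/-- `S` is a separating set of functionals on `X` such that each element of the bidual agrees on
`S` with an element of `X` of no larger norm. -/
def BidualTraceSet (𝕜 : Type*) [RCLike 𝕜] {X : Type*} [NormedAddCommGroup X] [NormedSpace 𝕜 X]
    (S : Set (StrongDual 𝕜 X)) : Prop :=
  (∀ x : X, (∀ f ∈ S, f x = 0) → x = 0) ∧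
    ∀ φ : StrongDual 𝕜 (StrongDual 𝕜 X), ∃ y : X, ‖y‖ ≤ ‖φ‖ ∧ ∀ f ∈ S, f y = φ f

variable {𝕜 : Type*} [RCLike 𝕜]

/-- Since `S` separates points, the vector agreeing with `φ` on `S` is unique; hence its choice is
linear in `φ` and fixes `X`. -/
theorem BidualTraceSet.oneComplementedInBidual {X : Type*} [NormedAddCommGroup X]
    [NormedSpace 𝕜 X] {S : Set (StrongDual 𝕜 X)} (hS : BidualTraceSet 𝕜 S) :
    OneComplementedInBidual 𝕜 X := by
  obtain ⟨hsep, hex⟩ := hS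
  choose y hy hyS using hex
  have huniq : ∀ u v : X, (∀ f ∈ S, f u = f v) → u = v := fun u v huv =>
    sub_eq_zero.1 (hsep _ fun f hf => by rw [map_sub, huv f hf, sub_self])
  let L : StrongDual 𝕜 (StrongDual 𝕜 X) →ₗ[𝕜] X :=
    { toFun := y
      map_add' := fun φ ψ => huniq _ _ fun f hf => by simp [hyS _ f hf]
      map_smul' := fun c φ => huniq _ _ fun f hf => by simp [hyS _ f hf] }
  let L' : StrongDual 𝕜 (StrongDual 𝕜 X) →L[𝕜] X :=
    L.mkContinuous 1 fun φ => (hy φ).trans_eq (one_mul _).symm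
  have hL : ∀ x, L' (NormedSpace.inclusionInDoubleDual 𝕜 X x) = x := fun x =>
    huniq _ _ fun f hf => hyS _ f hf
  refine ⟨(NormedSpace.inclusionInDoubleDual 𝕜 X).comp L', fun φ => ?_, ?_, ?_⟩
  · exact (NormedSpace.double_dual_bound 𝕜 X _).trans (hy φ)
  · ext1 φ
    simp [hL]
  · apply Set.Subset.antisymm
    · rintro _ ⟨φ, rfl⟩
      exact ⟨L' φ, rfl⟩
    · rintro _ ⟨x, rfl⟩
      exact ⟨NormedSpace.inclusionInDoubleDual 𝕜 X x, by simp [hL]⟩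

/-- Each functional is almost normed by a vector at which its value is real. -/
theorem exists_norm_le_one_lt_re {Z : Type*} [NormedAddCommGroup Z] [NormedSpace 𝕜 Z]
    (φ : StrongDual 𝕜 Z) {r : ℝ} (hr : r < ‖φ‖) : ∃ f : Z, ‖f‖ ≤ 1 ∧ r < RCLike.re (φ f) := by
  obtain ⟨f, hf, hrf⟩ := φ.exists_lt_apply_of_lt_opNorm hr
  obtain ⟨c, hc, hcf⟩ := RCLike.exists_norm_eq_mul_self (φ f)
  refine ⟨c • f, by rw [norm_smul, hc, one_mul]; exact hf.le, ?_⟩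
  rwa [map_smul, smul_eq_mul, ← hcf, RCLike.ofReal_re]

/-- The restrictions of `φ` to the duals of the summands have norms summing to at most `‖φ‖`, so the
vectors chosen in the summands assemble into one of the `ℓ₁`-sum. -/
theorem BidualTraceSet.lp_one {ι : Type*} {E : ι → Type*} [∀ i, NormedAddCommGroup (E i)]
    [∀ i, NormedSpace 𝕜 (E i)] {S : ∀ i, Set (StrongDual 𝕜 (E i))}
    (hS : ∀ i, BidualTraceSet 𝕜 (S i)) :
    BidualTraceSet 𝕜 (⋃ i, (fun f : StrongDual 𝕜 (E i) => f.comp (lp.evalCLM 𝕜 E 1 i)) '' S i) := by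
  classical
  constructor
  · intro x hx
    ext i
    exact (hS i).1 _ fun f hf => hx _ (Set.mem_iUnion.2 ⟨i, f, hf, rfl⟩)
  · intro φ
    let φi : ∀ i, StrongDual 𝕜 (StrongDual 𝕜 (E i)) := fun i =>
      φ.comp ((ContinuousLinearMap.compL 𝕜 (lp E 1) (E i) 𝕜).flip (lp.evalCLM 𝕜 E 1 i))
    have hφi : ∀ i f, φi i f = φ (f.comp (lp.evalCLM 𝕜 E 1 i)) := fun _ _ => rfl
    have hsum : ∀ F : Finset ι, ∑ i ∈ F, ‖φi i‖ ≤ ‖φ‖ := by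
      intro F
      refine le_of_forall_pos_le_add fun ε hε => ?_
      have hδ : 0 < ε / (F.card + 1) := by positivity
      choose f hf1 hf2 using fun i => exists_norm_le_one_lt_re (φi i) (sub_lt_self _ hδ)
      -- Functionals of norm at most `1` on different summands add up to one of norm at most `1`, so
      -- `φ g` sees all the norms at once.
      let g : StrongDual 𝕜 (lp E 1) := ∑ i ∈ F, (f i).comp (lp.evalCLM 𝕜 E 1 i)
      have hg : ‖g‖ ≤ 1 := by
        refine g.opNorm_le_bound zero_le_one fun x => ?_
        rw [one_mul]
        refine le_trans ?_ (lp.sum_norm_le_of_one x F)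
        simp only [g, sum_apply]
        refine norm_sum_le_of_le _ fun i _ => ?_
        exact ((f i).le_of_opNorm_le (hf1 i) _).trans_eq (one_mul _)
      have h1 : ∑ i ∈ F, (‖φi i‖ - ε / (F.card + 1)) ≤ RCLike.re (φ g) := by
        simp only [g, map_sum]
        exact Finset.sum_le_sum fun i _ => (hf2 i).le
      have h2 : RCLike.re (φ g) ≤ ‖φ‖ := (RCLike.re_le_norm _).trans (φ.unit_le_opNorm g hg)
      have h3 : (F.card : ℝ) * (ε / (F.card + 1)) ≤ ε := by
        rw [mul_div_assoc', div_le_iff₀ (by positivity)]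
        nlinarith
      rw [Finset.sum_sub_distrib, Finset.sum_const, nsmul_eq_mul] at h1
      linarith
    choose y hy hyS using fun i => (hS i).2 (φi i)
    have hysum : ∀ F : Finset ι, ∑ i ∈ F, ‖y i‖ ^ (1 : ℝ≥0∞).toReal ≤ ‖φ‖ ^ (1 : ℝ≥0∞).toReal :=
      fun F => by simpa using (Finset.sum_le_sum fun i _ => hy i).trans (hsum F)
    refine ⟨⟨y, memℓp_gen' hysum⟩,
      lp.norm_le_of_forall_sum_le (p := 1) (by simp) (norm_nonneg φ) hysum, fun g hg => ?_⟩
    obtain ⟨i, f, hf, rfl⟩ := Set.mem_iUnion.1 hg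
    exact hyS i f hf

end Bidual

/-- A criterion for the coordinate functionals of a basis whose norm is determined by the quantities
`a * ∑ k < K, |η k| + |∑ k ≤ n, η k|`. -/
theorem BidualTraceSet.of_coord {𝕜 : Type*} [RCLike 𝕜] {E : Type*} [NormedAddCommGroup E]
    [NormedSpace 𝕜 E] [CompleteSpace E] {a M : ℝ} (ha : 0 < a) {e : ℕ → StrongDual 𝕜 E} {v : ℕ → E}
    (hv : ∀ k, ‖v k‖ ≤ M) (hev : ∀ k j, e k (v j) = if k = j then 1 else 0)
    (hlower : ∀ y, ∀ K n : ℕ, a * ∑ k ∈ Finset.range K, ‖e k y‖ +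
      ‖∑ k ∈ Finset.range (n + 1), e k y‖ ≤ ‖y‖)
    (hupper : ∀ (y : E) (C : ℝ), (∀ K n : ℕ, a * ∑ k ∈ Finset.range K, ‖e k y‖ +
      ‖∑ k ∈ Finset.range (n + 1), e k y‖ ≤ C) → ‖y‖ ≤ C) :
    BidualTraceSet 𝕜 (Set.range e) := by
  constructor
  · intro x hx
    have h0 : ∀ k, e k x = 0 := fun k => hx _ ⟨k, rfl⟩
    exact norm_le_zero_iff.1 (hupper x 0 fun K n => by simp [h0])
  · intro φ
    have hbound : ∀ K n : ℕ, a * ∑ k ∈ Finset.range K, ‖φ (e k)‖ +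
        ‖∑ k ∈ Finset.range (n + 1), φ (e k)‖ ≤ ‖φ‖ := by
      intro K n
      choose c hc hcφ using fun k => RCLike.exists_norm_eq_mul_self (φ (e k))
      obtain ⟨d, hd, hdφ⟩ := RCLike.exists_norm_eq_mul_self (∑ k ∈ Finset.range (n + 1), φ (e k))
      -- The unimodular `c k` and `d` rotate all terms of `φ g` to be nonnegative, while `hlower`
      -- keeps `‖g‖ ≤ 1`.
      let g : StrongDual 𝕜 E :=
        (a : 𝕜) • ∑ k ∈ Finset.range K, c k • e k + d • ∑ k ∈ Finset.range (n + 1), e k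
      have hg : ‖g‖ ≤ 1 := by
        refine g.opNorm_le_bound zero_le_one fun y => ?_
        have hgy : g y = (a : 𝕜) * ∑ k ∈ Finset.range K, c k * e k y +
            d * ∑ k ∈ Finset.range (n + 1), e k y := by
          simp [g]
        rw [hgy, one_mul]
        refine ((norm_add_le _ _).trans (add_le_add ?_ ?_)).trans (hlower y K n)
        · rw [norm_mul, RCLike.norm_of_nonneg ha.le]
          refine mul_le_mul_of_nonneg_left (norm_sum_le_of_le _ fun k _ => ?_) ha.le
          rw [norm_mul, hc, one_mul]
        · rw [norm_mul, hd, one_mul]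
      have hφg : φ g = ((a * ∑ k ∈ Finset.range K, ‖φ (e k)‖ +
          ‖∑ k ∈ Finset.range (n + 1), φ (e k)‖ : ℝ) : 𝕜) := by
        rw [RCLike.ofReal_add, RCLike.ofReal_mul, RCLike.ofReal_sum, hdφ]
        simp [g, hcφ]
      calc _ = ‖φ g‖ := by
            rw [hφg, RCLike.norm_of_nonneg]
            positivity
        _ ≤ ‖φ‖ := φ.unit_le_opNorm g hg
    have hsummable : Summable fun k => ‖φ (e k)‖ := by
      refine summable_of_sum_range_le (c := a⁻¹ * ‖φ‖) (fun _ => norm_nonneg _) fun K => ?_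
      rw [← div_eq_inv_mul, le_div_iff₀' ha]
      exact (le_add_of_nonneg_right (norm_nonneg _)).trans (hbound K 0)
    have hvec : Summable fun k => φ (e k) • v k := by
      refine .of_norm_bounded (hsummable.mul_right M) fun k => ?_
      rw [norm_smul]
      exact mul_le_mul_of_nonneg_left (hv k) (norm_nonneg _)
    have hcoord : ∀ k, e k (∑' j, φ (e j) • v j) = φ (e k) := fun k => by
      rw [(e k).map_tsum hvec, tsum_eq_single k]
      · simp [hev]
      · intro j hj
        simp [hev, hj.symm]
    refine ⟨∑' j, φ (e j) • v j, hupper _ _ fun K n => ?_, ?_⟩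
    · simp only [hcoord]
      exact hbound K n
    · rintro _ ⟨k, rfl⟩
      exact hcoord k

/-! ### The spaces `X_α` as renormings of `ℓ₁` -/

theorem ContinuousMap.norm_le_of_forall_natCast {F : Type*} [NormedAddCommGroup F] (f : C(ℕ∞, F))
    {C : ℝ} (hf : ∀ n : ℕ, ‖f n‖ ≤ C) : ‖f‖ ≤ C := by
  refine (f.norm_le ((norm_nonneg _).trans (hf 0))).2 fun a => ?_
  induction a using ENat.recTopCoe with
  | top => exact le_of_tendsto' ((f.continuous.tendsto ⊤).comp ENat.tendsto_natCast_nhds_top).norm hf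
  | coe n => exact hf n

theorem chi_natCast (𝕜 : Type*) [RCLike 𝕜] (k n : ℕ) :
    chi 𝕜 k (n : ℕ∞) = if k ≤ n then 1 else 0 := by
  simp [chi, Set.indicator_apply]

theorem chi_top (𝕜 : Type*) [RCLike 𝕜] (k : ℕ) : chi 𝕜 k ⊤ = 1 := by
  simp [chi]

namespace ScaledL1

variable {𝕜 : Type*} [RCLike 𝕜] {α : {r : ℝ // 0 < r}}

/-- The identity map from `(ℓ₁, α ‖·‖₁)` to `ℓ₁`. -/
noncomputable def toL1 : ScaledL1 𝕜 α ≃L[𝕜] lp (fun _ : ℕ => 𝕜) 1 :=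
  (ofL1 𝕜 α).symm.toContinuousLinearEquivOfBounds (α : ℝ)⁻¹ α
    (fun η => by rw [norm_def, inv_mul_cancel_left₀ α.2.ne'])
    (fun η => by rw [norm_def]; rfl)

instance : CompleteSpace (ScaledL1 𝕜 α) :=
  (completeSpace_congr (e := (toL1 (𝕜 := 𝕜) (α := α)).toEquiv) toL1.isUniformEmbedding).2
    inferInstance

end ScaledL1

namespace XAlpha

variable {𝕜 : Type*} [RCLike 𝕜] {α : {r : ℝ // 0 < r}}

instance : CompleteSpace (XAlpha 𝕜 α) :=
  (Submodule.isClosed_topologicalClosure _).completeSpace_coe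

instance : TopologicalSpace.SeparableSpace (XAlpha 𝕜 α) := by
  have h := ((Set.countable_range (xVec 𝕜 α)).isSeparable.span (R := 𝕜)).closure
  rw [← Submodule.topologicalClosure_coe] at h
  exact h.separableSpace

/-- The first component of an element of `X_α`. -/
noncomputable def l1Part : XAlpha 𝕜 α →L[𝕜] lp (fun _ : ℕ => 𝕜) 1 :=
  (ScaledL1.toL1 (𝕜 := 𝕜) (α := α)).toContinuousLinearMap.comp
    ((WithLp.fstL 1 𝕜 _ _).comp (XAlpha 𝕜 α).subtypeL)

/-- The second component of an element of `X_α`. -/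
noncomputable def fnPart : XAlpha 𝕜 α →L[𝕜] C(ℕ∞, 𝕜) :=
  (WithLp.sndL 1 𝕜 _ _).comp (XAlpha 𝕜 α).subtypeL

/-- The vector `x_k` as an element of `X_α`. -/
noncomputable def vec (𝕜 : Type*) [RCLike 𝕜] (α : {r : ℝ // 0 < r}) (k : ℕ) : XAlpha 𝕜 α :=
  ⟨xVec 𝕜 α k, Submodule.le_topologicalClosure _ (Submodule.subset_span ⟨k, rfl⟩)⟩

theorem l1Part_vec (k : ℕ) : l1Part (vec 𝕜 α k) = lp.single 1 k 1 := rfl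

theorem fnPart_vec (k : ℕ) : fnPart (vec 𝕜 α k) = chi 𝕜 k := rfl

theorem norm_eq (y : XAlpha 𝕜 α) : ‖y‖ = α * ‖l1Part y‖ + ‖fnPart y‖ :=
  WithLp.prod_norm_eq_of_L1 y.1

theorem norm_fnPart_le_norm (y : XAlpha 𝕜 α) : ‖fnPart y‖ ≤ ‖y‖ := by
  rw [norm_eq]
  exact le_add_of_nonneg_left (mul_nonneg α.2.le (norm_nonneg _))

/-- Both sides are continuous and linear and agree on each `x_k`, hence on the closed span. -/
theorem fnPart_natCast (y : XAlpha 𝕜 α) (n : ℕ) :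
    fnPart y (n : ℕ∞) = ∑ k ∈ Finset.range (n + 1), l1Part y k := by
  let h : YSpace 𝕜 α →L[𝕜] 𝕜 := (ContinuousMap.evalCLM 𝕜 (n : ℕ∞)).comp (WithLp.sndL 1 𝕜 _ _) -
    ∑ k ∈ Finset.range (n + 1), (lp.evalCLM 𝕜 (fun _ : ℕ => 𝕜) 1 k).comp
      ((ScaledL1.toL1 (𝕜 := 𝕜) (α := α)).toContinuousLinearMap.comp (WithLp.fstL 1 𝕜 _ _))
  have hker : XAlpha 𝕜 α ≤ h.ker := by
    refine Submodule.topologicalClosure_minimal _ (Submodule.span_le.2 ?_) h.isClosed_ker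
    rintro _ ⟨k, rfl⟩
    have h1 : h (xVec 𝕜 α k) = chi 𝕜 k (n : ℕ∞) -
        ∑ j ∈ Finset.range (n + 1), (lp.single 1 k 1 : lp (fun _ : ℕ => 𝕜) 1) j := by
      simp only [h, sub_apply, sum_apply]
      rfl
    change h (xVec 𝕜 α k) = 0
    rw [h1, chi_natCast]
    simp [lp.single_apply, Pi.single_apply]
  have h2 : h y.1 = fnPart y (n : ℕ∞) - ∑ k ∈ Finset.range (n + 1), l1Part y k := by
    simp only [h, sub_apply, sum_apply]
    rfl
  exact sub_eq_zero.1 (h2 ▸ hker y.2)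

theorem norm_fnPart_le (y : XAlpha 𝕜 α) : ‖fnPart y‖ ≤ ‖l1Part y‖ := by
  refine ContinuousMap.norm_le_of_forall_natCast _ fun n => ?_
  rw [fnPart_natCast]
  exact (norm_sum_le _ _).trans (lp.sum_norm_le_of_one _ _)

theorem norm_le_mul_norm_l1Part (y : XAlpha 𝕜 α) : ‖y‖ ≤ (α + 1) * ‖l1Part y‖ := by
  rw [norm_eq]
  linarith [norm_fnPart_le y]

theorem norm_vec_le (k : ℕ) : ‖vec 𝕜 α k‖ ≤ α + 1 := by
  refine (norm_le_mul_norm_l1Part _).trans_eq ?_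
  rw [l1Part_vec, lp.norm_single zero_lt_one, norm_one, mul_one]

/-- Because `K` and `n` are independent, the supremum over `n` can be taken for fixed `K` before `K`
tends to infinity. -/
theorem norm_le_of_forall {y : XAlpha 𝕜 α} {C : ℝ}
    (h : ∀ K n : ℕ, α * ∑ k ∈ Finset.range K, ‖l1Part y k‖ +
      ‖∑ k ∈ Finset.range (n + 1), l1Part y k‖ ≤ C) : ‖y‖ ≤ C := by
  have h1 : ∀ K : ℕ, α * ∑ k ∈ Finset.range K, ‖l1Part y k‖ + ‖fnPart y‖ ≤ C := fun K => by
    rw [← le_sub_iff_add_le']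
    refine ContinuousMap.norm_le_of_forall_natCast _ fun n => ?_
    rw [fnPart_natCast, le_sub_iff_add_le']
    exact h K n
  rw [norm_eq]
  have h2 := (lp.summable_norm_of_one (l1Part y)).hasSum.tendsto_sum_nat
  rw [← lp.norm_eq_tsum_of_one] at h2
  exact le_of_tendsto' ((h2.const_mul (α : ℝ)).add_const _) h1

theorem schurProperty : SchurProperty 𝕜 (XAlpha 𝕜 α) :=
  (schurProperty_lp_one fun _ => schurProperty_scalar).of_antilipschitz l1Part
    norm_le_mul_norm_l1Part

/-- The `k`-th coordinate functional. -/
noncomputable def coord (k : ℕ) : StrongDual 𝕜 (XAlpha 𝕜 α) :=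
  (lp.evalCLM 𝕜 (fun _ : ℕ => 𝕜) 1 k).comp l1Part

theorem coord_apply (k : ℕ) (y : XAlpha 𝕜 α) : coord k y = l1Part y k := rfl

theorem coord_vec (k j : ℕ) : coord k (vec 𝕜 α j) = if k = j then 1 else 0 := by
  rw [coord_apply, l1Part_vec]
  simp [lp.single_apply, Pi.single_apply]

theorem bidualTraceSet : BidualTraceSet 𝕜 (Set.range (coord (𝕜 := 𝕜) (α := α))) := by
  refine .of_coord α.2 norm_vec_le coord_vec (fun y K n => ?_) fun y C h => norm_le_of_forall h
  simp only [coord_apply]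
  rw [norm_eq, ← fnPart_natCast]
  exact add_le_add (mul_le_mul_of_nonneg_left (lp.sum_norm_le_of_one _ _) α.2.le)
    ((fnPart y).norm_coe_le_norm _)

end XAlpha

/-! ### Weak* cluster points of `(x_k)` in one summand -/

section Cluster

variable {𝕜 : Type*} [RCLike 𝕜]

/-- Evaluation at `f` is weak* continuous, so `φ f` is a cluster point of the scalars `f (x k)`. -/
theorem apply_mem_of_mem_clust {X : Type*} [NormedAddCommGroup X] [NormedSpace 𝕜 X] {x : ℕ → X}
    {φ : StrongDual 𝕜 (StrongDual 𝕜 X)} (hφ : φ ∈ clust 𝕜 x) (f : StrongDual 𝕜 X) {s : Set 𝕜}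
    (hs : IsClosed s) (hx : ∀ᶠ k in atTop, f (x k) ∈ s) : φ f ∈ s := by
  by_contra hcon
  have hφ' : MapClusterPt (StrongDual.toWeakDual φ) atTop
    fun k => StrongDual.toWeakDual (NormedSpace.inclusionInDoubleDual 𝕜 X (x k)) := hφ
  have h1 : MapClusterPt (φ f) atTop fun k => f (x k) :=
    hφ'.continuousAt_comp (WeakDual.eval_continuous f).continuousAt
  obtain ⟨k, hk, hk'⟩ := ((h1.frequently (hs.isOpen_compl.mem_nhds hcon)).and_eventually hx).exists
  exact hk hk'

/-- The sequence of the functions `χ_[k, ω]` is weakly Cauchy in `C[1, ω]`. -/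
theorem cauchySeq_apply_chi (μ : StrongDual 𝕜 C(ℕ∞, 𝕜)) : CauchySeq fun k => μ (chi 𝕜 k) := by
  refine cauchySeq_of_summable_dist
    (summable_of_sum_range_le (c := ‖μ‖) (fun _ => dist_nonneg) fun N => ?_)
  choose c hc hcμ using fun k => RCLike.exists_norm_eq_mul_self (μ (chi 𝕜 k) - μ (chi 𝕜 (k + 1)))
  -- The differences of consecutive `chi` are indicators of distinct points, so unimodular
  -- combinations have norm at most `1`; the increments of `μ (chi 𝕜 k)` are therefore absolutely
  -- summable.
  let h : C(ℕ∞, 𝕜) := ∑ k ∈ Finset.range N, c k • (chi 𝕜 k - chi 𝕜 (k + 1))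
  have hh : ‖h‖ ≤ 1 := by
    refine ContinuousMap.norm_le_of_forall_natCast _ fun n => ?_
    have h1 : ∀ k, chi 𝕜 k (n : ℕ∞) - chi 𝕜 (k + 1) (n : ℕ∞) = if n = k then 1 else 0 := by
      intro k
      rw [chi_natCast, chi_natCast]
      rcases lt_trichotomy n k with hnk | rfl | hnk
      · simp [hnk.not_ge, hnk.ne, show ¬ k + 1 ≤ n by omega]
      · simp
      · simp [hnk.le, hnk.ne', show k + 1 ≤ n by omega]
    have h2 : h (n : ℕ∞) = if n ∈ Finset.range N then c n else 0 := by
      simp only [h, ContinuousMap.sum_apply, ContinuousMap.smul_apply, ContinuousMap.sub_apply, h1,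
        smul_eq_mul, mul_ite, mul_one, mul_zero, Finset.sum_ite_eq]
    rw [h2]
    split_ifs
    · exact (hc n).le
    · simp
  have hμ : μ h = ((∑ k ∈ Finset.range N, dist (μ (chi 𝕜 k)) (μ (chi 𝕜 (k + 1))) : ℝ) : 𝕜) := by
    push_cast
    simp only [h, map_sum, map_smul, map_sub, dist_eq_norm, hcμ, smul_eq_mul]
  calc _ = ‖μ h‖ := by
        rw [hμ, RCLike.norm_of_nonneg (Finset.sum_nonneg fun _ _ => dist_nonneg)]
    _ ≤ ‖μ‖ := μ.unit_le_opNorm h hh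

namespace XAlpha

variable {α : {r : ℝ // 0 < r}}

/-- The values of a functional on the vectors `x_k` accumulate in a ball of radius at most `α` times
the norm of the functional. -/
theorem exists_eventually_apply_vec_mem (g : StrongDual 𝕜 (XAlpha 𝕜 α)) :
    ∃ c : 𝕜, ∀ ε > 0, ∀ᶠ k in atTop, g (vec 𝕜 α k) ∈ Metric.closedBall c (α * ‖g‖ + ε) := by
  -- Extending to `Y_α` lets the two components of `x_k` be tested separately: the second gives the
  -- limit `c`, the first an error of at most `α * ‖g‖`.
  obtain ⟨G, hG, hnorm⟩ := exists_extension_norm_eq (XAlpha 𝕜 α) g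
  let μ : StrongDual 𝕜 C(ℕ∞, 𝕜) :=
    G.comp ((WithLp.prodContinuousLinearEquiv 1 𝕜 (ScaledL1 𝕜 α)
      C(ℕ∞, 𝕜)).symm.toContinuousLinearMap.comp (ContinuousLinearMap.inr 𝕜 (ScaledL1 𝕜 α) C(ℕ∞, 𝕜)))
  obtain ⟨c, hc⟩ := cauchySeq_tendsto_of_complete (cauchySeq_apply_chi μ)
  refine ⟨c, fun ε hε => ?_⟩
  filter_upwards [hc.eventually (Metric.closedBall_mem_nhds c hε)] with k hk
  let e : YSpace 𝕜 α := WithLp.toLp 1 (ScaledL1.ofL1 𝕜 α (lp.single 1 k 1), 0)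
  have he : ‖e‖ = α := by
    have h1 : ‖e‖ = ‖e.fst‖ + ‖e.snd‖ := WithLp.prod_norm_eq_of_L1 e
    have h2 : ‖e.fst‖ = α * ‖(lp.single 1 k 1 : lp (fun _ : ℕ => 𝕜) 1)‖ := rfl
    have h3 : e.snd = 0 := rfl
    rw [h1, h2, h3, lp.norm_single zero_lt_one, norm_one, norm_zero, mul_one, add_zero]
  have hsplit : g (vec 𝕜 α k) = G e + μ (chi 𝕜 k) := by
    rw [← hG]
    change G (xVec 𝕜 α k) = G e + G (WithLp.toLp 1 (0, chi 𝕜 k))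
    rw [← map_add, ← WithLp.toLp_add, Prod.mk_add_mk, add_zero, zero_add]
    rfl
  rw [dist_eq_norm] at hk
  rw [mem_closedBall_iff_norm]
  rw [hsplit, add_sub_assoc]
  refine (norm_add_le _ _).trans (add_le_add ?_ hk)
  refine (G.le_opNorm e).trans_eq ?_
  rw [he, hnorm, mul_comm]

end XAlpha

variable (𝕜) in
/-- The sequence `(x_k)` in the `n`-th summand of the space `X`. -/
noncomputable def summandVec (n : ℕ+) (k : ℕ) : XSpace 𝕜 :=
  lp.single 1 n (XAlpha.vec 𝕜 (oneDiv n) k)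

theorem isBounded_range_summandVec (n : ℕ+) :
    Bornology.IsBounded (Set.range (summandVec 𝕜 n)) := by
  refine isBounded_iff_forall_norm_le.2 ⟨oneDiv n + 1, ?_⟩
  rintro _ ⟨k, rfl⟩
  rw [summandVec, lp.norm_single zero_lt_one]
  exact XAlpha.norm_vec_le k

/-- For each `g`, the values of all cluster points lie in balls about one common centre, with radii
arbitrarily close to at most `‖g‖ / n`. -/
theorem deltaX_summandVec_le (n : ℕ+) :
    deltaX 𝕜 (summandVec 𝕜 n) ≤ ENNReal.ofReal (2 * oneDiv n) := by
  have hα : (0 : ℝ) < oneDiv n := (oneDiv n).2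
  refine Metric.ediam_le fun φ hφ ψ hψ => ?_
  rw [edist_dist, dist_eq_norm]
  refine ENNReal.ofReal_le_ofReal (ContinuousLinearMap.opNorm_le_bound _ (by positivity) fun g => ?_)
  let J : XAlpha 𝕜 (oneDiv n) →L[𝕜] XSpace 𝕜 :=
    lp.singleContinuousLinearMap 𝕜 (fun n : ℕ+ => XAlpha 𝕜 (oneDiv n)) 1 n
  obtain ⟨c, hc⟩ := XAlpha.exists_eventually_apply_vec_mem (g.comp J)
  have hJ : ‖g.comp J‖ ≤ ‖g‖ := by
    refine (g.comp J).opNorm_le_bound (norm_nonneg g) fun y => ?_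
    refine (g.le_opNorm (J y)).trans_eq ?_
    rw [lp.singleContinuousLinearMap_apply, lp.norm_single zero_lt_one]
  refine le_of_forall_pos_le_add fun ε hε => ?_
  have h1 := apply_mem_of_mem_clust hφ g Metric.isClosed_closedBall (hc (ε / 2) (half_pos hε))
  have h2 := apply_mem_of_mem_clust hψ g Metric.isClosed_closedBall (hc (ε / 2) (half_pos hε))
  have h3 := dist_triangle_right (φ g) (ψ g) c
  rw [Metric.mem_closedBall] at h1 h2
  rw [sub_apply, ← dist_eq_norm]
  nlinarith [mul_le_mul_of_nonneg_left hJ hα.le]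

theorem le_distClust_summandVec (n : ℕ+) :
    ENNReal.ofReal (1 / 2) ≤ distClust 𝕜 (summandVec 𝕜 n) := by
  refine le_iInf₂ fun φ hφ => le_iInf fun y => ?_
  rw [edist_dist, dist_eq_norm]
  refine ENNReal.ofReal_le_ofReal ?_
  let ev : XSpace 𝕜 →L[𝕜] C(ℕ∞, 𝕜) :=
    XAlpha.fnPart.comp (lp.evalCLM 𝕜 (fun n : ℕ+ => XAlpha 𝕜 (oneDiv n)) 1 n)
  have hev : ∀ x, ‖ev x‖ ≤ ‖x‖ := fun x =>
    (XAlpha.norm_fnPart_le_norm (x n)).trans (lp.norm_apply_le_norm one_ne_zero x n)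
  let h : ℕ → StrongDual 𝕜 (XSpace 𝕜) := fun m =>
    ((ContinuousMap.evalCLM 𝕜 (⊤ : ℕ∞) : StrongDual 𝕜 C(ℕ∞, 𝕜)) -
      (ContinuousMap.evalCLM 𝕜 (m : ℕ∞) : StrongDual 𝕜 C(ℕ∞, 𝕜))).comp ev
  have happ : ∀ m x, h m x = ev x ⊤ - ev x m := fun _ _ => rfl
  have hnorm : ∀ m, ‖h m‖ ≤ 2 := fun m => by
    refine (h m).opNorm_le_bound zero_le_two fun x => ?_
    rw [happ, two_mul]
    refine (norm_sub_le _ _).trans (add_le_add ?_ ?_) <;>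
      exact ((ev x).norm_coe_le_norm _).trans (hev x)
  -- For `k > m` the function `χ_[k, ω]` is `1` at `ω` and `0` at `m`.
  have hφ1 : ∀ m, φ (h m) = 1 := fun m => by
    refine apply_mem_of_mem_clust hφ (h m) isClosed_singleton ?_
    filter_upwards [eventually_gt_atTop m] with k hk
    have hevk : ev (summandVec 𝕜 n k) = chi 𝕜 k := by
      change XAlpha.fnPart (summandVec 𝕜 n k n) = _
      rw [summandVec, lp.single_apply_self, XAlpha.fnPart_vec]
    rw [Set.mem_singleton_iff, happ, hevk, chi_top, chi_natCast, if_neg hk.not_ge, sub_zero]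
  have hlim : Tendsto (fun m => ‖1 - h m y‖) atTop (𝓝 1) := by
    have h1 : Tendsto (fun m : ℕ => ev y m) atTop (𝓝 (ev y ⊤)) :=
      ((ev y).continuous.tendsto ⊤).comp ENat.tendsto_natCast_nhds_top
    have h2 := ((tendsto_const_nhds (x := (1 : 𝕜))).sub
      ((tendsto_const_nhds (x := ev y ⊤)).sub h1)).norm
    simpa only [happ, sub_self, sub_zero, norm_one] using h2
  -- The factor `2` bounds `‖h m‖`; it makes the distance `1 / 2`.
  have hle : 1 ≤ 2 * ‖φ - NormedSpace.inclusionInDoubleDual 𝕜 (XSpace 𝕜) y‖ := by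
    refine le_of_tendsto' hlim fun m => ?_
    have h1 : 1 - h m y = (φ - NormedSpace.inclusionInDoubleDual 𝕜 (XSpace 𝕜) y) (h m) := by
      rw [sub_apply, hφ1, NormedSpace.dual_def]
    rw [h1, mul_comm]
    exact (ContinuousLinearMap.le_opNorm _ _).trans
      (mul_le_mul_of_nonneg_left (hnorm m) (norm_nonneg _))
  linarith

end Cluster

theorem mainTheorem2 (𝕜 : Type*) [RCLike 𝕜] :
    CompleteSpace (XSpace 𝕜) ∧
    TopologicalSpace.SeparableSpace (XSpace 𝕜) ∧
    SchurProperty 𝕜 (XSpace 𝕜) ∧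
    WeaklySequentiallyComplete 𝕜 (XSpace 𝕜) ∧
    OneComplementedInBidual 𝕜 (XSpace 𝕜) ∧
    ¬ ∃ C : ℝ≥0, ∀ x : ℕ → XSpace 𝕜, Bornology.IsBounded (Set.range x) →
      distClust 𝕜 x ≤ (C : ℝ≥0∞) * deltaX 𝕜 x := by
  have hschur : SchurProperty 𝕜 (XSpace 𝕜) := schurProperty_lp_one fun _ => XAlpha.schurProperty
  refine ⟨inferInstance, separableSpace_lp_one, hschur, hschur.weaklySequentiallyComplete,
    (BidualTraceSet.lp_one fun n : ℕ+ =>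
      XAlpha.bidualTraceSet (𝕜 := 𝕜) (α := oneDiv n)).oneComplementedInBidual, ?_⟩
  rintro ⟨C, hC⟩
  -- The two estimates would give `1 / 2 ≤ 2 * C / m`, that is `m ≤ 4 * C`.
  obtain ⟨m, hm⟩ := exists_nat_gt (4 * (C : ℝ))
  have hm0 : (0 : ℝ) < m := lt_of_le_of_lt (by positivity) hm
  let n : ℕ+ := ⟨m, Nat.cast_pos.1 hm0⟩
  have hn : ((oneDiv n : {r : ℝ // 0 < r}) : ℝ) = 1 / m := rfl
  have h1 : ENNReal.ofReal (1 / 2) ≤ (C : ℝ≥0∞) * ENNReal.ofReal (2 * oneDiv n) :=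
    (le_distClust_summandVec n).trans ((hC _ (isBounded_range_summandVec n)).trans
      (mul_le_mul_right (deltaX_summandVec_le n) _))
  rw [← ENNReal.ofReal_coe_nnreal, ← ENNReal.ofReal_mul C.coe_nonneg, hn,
    ENNReal.ofReal_le_ofReal_iff (by positivity), ← mul_assoc, mul_one_div,
    div_le_div_iff₀ two_pos hm0] at h1
  linarith
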